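/- Let $k\ge 2$ be an integer and let $\gamma=1/g$ for an integer $g\ge 2$. For $n\in\mathbb N$ let $V=\{1,\dots,n\}^k$ be the $k$-dimensional grid with wrap-around distance $d(u,v)=\sum_{i=1}^k\min\{|u_i-v_i|,\,n-|u_i-v_i|\}$. In the distance-reciprocity balanced (DRB) game the players are the nodes $u\in V$, each with strategy set $\Sigma=\{0,\gamma,2\gamma,3\gamma,\dots\}$, and the payoff of $u$ in the profile $\mathbf r=(r_v)_{v\in V}\in\Sigma^V$ is $$\pi_u(\mathbf r)=\Bigl(\sum_{v\ne u}p_u(v,r_u)\,d(u,v)\Bigr)\Bigl(\sum_{v\ne u}p_u(v,r_u)\,p_v(u,r_v)\Bigr),\qquad p_u(v,s)=\frac{d(u,v)^{-s}}{\sum_{w\neq u}d(u,w)^{-s}}.$$ A strategy $s\in\Sigma$ is a best response of $u$ to $\mathbf r$ if $\pi_u(s,\mathbf r_{-u})\ge\pi_u(s',\mathbf r_{-u})$ for all $s'\in\Sigma$. In a synchronous step every node moves simultaneously to a best response to the current profile; in an asynchronous step a single node moves to a best response to the current profile and all other nodes keep their strategies. Then for every constant $\varepsilon$ with $0<\varepsilon<\gamma/4$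 there is an $n_0$, depending only on $k$, $\gamma$ and $\varepsilon$, such that for all $n\ge n_0$ the following holds. Start from the profile $\mathbf r\equiv k$ (that is, $r_u=k$ for all $u\in V$). Let the nodes be perturbed independently of each other, node $u$ with probability $p_u$, where $p_u\le 1-n^{-\varepsilon}$ for all $u\in V$. Then with probability at least $1-1/n$ the set of perturbed nodes is such that, for every profile $\mathbf r'\in\Sigma^V$ with $r'_u=k$ for all unperturbed $u$ (the strategies of the perturbed nodes being arbitrary): 1. one synchronous step is possible from $\mathbf r'$, and every such step leads to $\mathbf r\equiv k$; 2. for every finite sequence of nodes (repetitions allowed) in which each node of $V$ occurs at least once, asynchronous steps can be taken from $\mathbf r'$ by the nodes in this order, and however the best responses are chosen, the resulting profile is $\mathbf r\equiv k$. -/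

import Mathlib

/-! ## Best response dynamics of a strategic game -/

section Game

variable {V S : Type*} [DecidableEq V]

/-- In the game with payoffs `π`, the strategy `s` is a best response of player `u` to the
strategies of the other players in the profile `r` (the entry `r u` is overwritten). -/
def IsBestResponse (π : V → (V → S) → ℝ) (r : V → S) (u : V) (s : S) : Prop :=
  ∀ s' : S, π u (Function.update r u s') ≤ π u (Function.update r u s)

/-- One synchronous step: every player moves to a best response to the current profile `r`. -/
def SyncStep (π : V → (V → S) → ℝ) (r r' : V → S) : Prop :=
  ∀ u : V, IsBestResponse π r u (r' u)

/-- `AsyncRun π r l r'`: starting from `r`, the players in the list `l` take, one after the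
other, an asynchronous step (the player moves to a best response to the profile that is then
current, all others stay), and the resulting profile is `r'`. -/
inductive AsyncRun (π : V → (V → S) → ℝ) : (V → S) → List V → (V → S) → Prop
  | nil (r : V → S) : AsyncRun π r [] r
  | cons (r : V → S) (u : V) (s : S) (l : List V) (r' : V → S)
      (hs : IsBestResponse π r u s) (hl : AsyncRun π (Function.update r u s) l r') :
      AsyncRun π r (u :: l) r'

/-- From `r`, one synchronous step of the best response dynamic can be made, and it always leads
to `t`. -/
def ReturnsInOneSyncStep (π : V → (V → S) → ℝ) (r t : V → S) : Prop :=
  SyncStep π r t ∧ ∀ r' : V → S, SyncStep π r r' → r' = t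

/-- From `r`, whatever the (finite) order in which players take asynchronous best response steps,
once every player has taken at least one step (players may take several steps), the profile is
`t`; moreover the steps can indeed be made, in any order. -/
def ReturnsOnceAllMoved (π : V → (V → S) → ℝ) (r t : V → S) : Prop :=
  ∀ l : List V, (∀ u : V, u ∈ l) →
    AsyncRun π r l t ∧ ∀ r' : V → S, AsyncRun π r l r' → r' = t

end Game

/-! ## The distance-reciprocity balanced game on the `k`-dimensional torus grid -/

/-- The nodes of the `k`-dimensional `n × ⋯ × n` grid. -/
abbrev Grid (k n : ℕ) : Type := Fin k → Fin n

/-- Wrap-around Manhattan distance: `∑ i, min {|u i - v i|, n - |u i - v i|}`. -/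
def gridDist {k n : ℕ} (u v : Grid k n) : ℕ :=
  ∑ i : Fin k, min ((u i : ℤ) - (v i : ℤ)).natAbs (n - ((u i : ℤ) - (v i : ℤ)).natAbs)

/-- The strategy set `{0, γ, 2γ, 3γ, …}`. -/
def strategySet (γ : ℝ) : Set ℝ := {x | ∃ m : ℕ, x = m * γ}

theorem natCast_mem_strategySet {γ : ℝ} {g : ℕ} (hg : 2 ≤ g) (hγ : γ = 1 / (g : ℝ)) (k : ℕ) :
    (k : ℝ) ∈ strategySet γ := by
  have h : (g : ℝ) ≠ 0 := by
    have : g ≠ 0 := by omega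
    exact_mod_cast this
  refine ⟨k * g, ?_⟩
  rw [hγ]
  push_cast
  field_simp

/-- The normalization constant `c(s) = ∑_{v ≠ u} d(u, v) ^ (-s)` of node `u`. -/
noncomputable def linkNorm {k n : ℕ} (u : Grid k n) (s : ℝ) : ℝ :=
  ∑ v ∈ Finset.univ.erase u, (gridDist u v : ℝ) ^ (-s)

/-- For `v ≠ u`, the probability `p_u(v, s) = d(u, v) ^ (-s) / c(s)` that a long-range link of `u`
ends in `v` when `u` has connection preference `s`. -/
noncomputable def linkProb {k n : ℕ} (u v : Grid k n) (s : ℝ) : ℝ :=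
  (gridDist u v : ℝ) ^ (-s) / linkNorm u s

/-- The payoff of `u` in the distance-reciprocity balanced (DRB) game: the mean grid distance of
its long-range contacts times its reciprocity. -/
noncomputable def drbPayoff {k n : ℕ} (γ : ℝ) (u : Grid k n) (r : Grid k n → strategySet γ) : ℝ :=
  (∑ v ∈ Finset.univ.erase u, linkProb u v (r u) * (gridDist u v : ℝ)) *
    (∑ v ∈ Finset.univ.erase u, linkProb u v (r u) * linkProb v u (r v))

/-- The uniform profile `r ≡ k` (navigable small world). -/
def navigableProfile {γ : ℝ} {g : ℕ} (hg : 2 ≤ g) (hγ : γ = 1 / (g : ℝ)) (k n : ℕ) :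
    Grid k n → strategySet γ :=
  fun _ => ⟨(k : ℝ), natCast_mem_strategySet hg hγ k⟩

/-! The strategy `k` beats every other one by a power of `n`, however the perturbed nodes play, as
soon as each node has an unperturbed node nearby. By `linkProb_le`, a link from `v` to `u` has
probability `O(d ^ (-k))` for every nonnegative exponent, and the sum of `d ^ (-k)` is
polylogarithmic. Hence exponents at most `k - γ` lose a factor `n ^ γ` in reciprocity
(`drbPayoff_le_of_le`) and exponents at least `k + γ` lose it in mean distance
(`drbPayoff_le_of_ge`): both earn at most `n ^ (1 - γ)` up to logarithms. With an unperturbed node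
within distance `R`, playing `k` earns `n / R ^ (2 * k)` up to logarithms (`le_drbPayoff`).

Take `R = k * L` with `L ^ k` of order `n ^ (γ / 3)`. Then `k` earns about `n ^ (1 - 2γ/3)` and
wins, while a box of side `L` is fully perturbed with probability at most `exp (-n ^ (-ε) * (L ^ k -
1))`, small enough for a union bound because `ε < γ / 3`. Since every move lands on `k`, the
unperturbed nodes stay at `k` and the argument applies again at each step. -/

/-! ### Dynamics with a unique best response -/

theorem AsyncRun.eq_const_of_unique {V S : Type*} [DecidableEq V] {π : V → (V → S) → ℝ}
    {t : V → S} {U : Set V}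
    (h : ∀ r : V → S, (∀ v ∈ U, r v = t v) → ∀ u s, IsBestResponse π r u s ↔ s = t u)
    {r : V → S} {l : List V} {r' : V → S} (hrun : AsyncRun π r l r')
    (hr : ∀ v ∈ U, r v = t v) (A : Set V) (hA : ∀ v ∈ A, r v = t v)
    (hcover : ∀ v, v ∈ A ∨ v ∈ l) : r' = t := by
  induction hrun generalizing A with
  | nil r => exact funext fun v => hA v (by simpa using hcover v)
  | cons r u s l r' hs hl ih =>
    obtain rfl := (h r hr u s).1 hs
    -- `A` collects the players already known to be at `t`; the mover joins it, and agreement with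
    -- `t` on `U` survives.
    refine ih ?_ (insert u A) ?_ ?_
    · intro v hv
      by_cases hvu : v = u
      · subst hvu; simp
      · simpa [hvu] using hr v hv
    · intro v hv
      by_cases hvu : v = u
      · subst hvu; simp
      · simpa [hvu] using hA v (hv.resolve_left hvu)
    · intro v
      rcases hcover v with hv | hv
      · exact .inl (.inr hv)
      · rcases List.mem_cons.1 hv with rfl | hv
        · exact .inl (.inl rfl)
        · exact .inr hv

theorem AsyncRun.exists_of_unique {V S : Type*} [DecidableEq V] {π : V → (V → S) → ℝ}
    {t : V → S} {U : Set V}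
    (h : ∀ r : V → S, (∀ v ∈ U, r v = t v) → ∀ u s, IsBestResponse π r u s ↔ s = t u)
    (l : List V) (r : V → S) (hr : ∀ v ∈ U, r v = t v) : ∃ r', AsyncRun π r l r' := by
  induction l generalizing r with
  | nil => exact ⟨r, .nil r⟩
  | cons u l ih =>
    obtain ⟨r', hr'⟩ := ih (Function.update r u (t u)) (fun v hv => by
      by_cases hvu : v = u
      · subst hvu; simp
      · simpa [hvu] using hr v hv)
    exact ⟨r', .cons r u (t u) l r' ((h r hr u _).2 rfl) hr'⟩

/-- If `t u` is the unique best response of every player `u` to every profile that agrees with `t`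
on `U`, then both dynamics return to `t` from all these profiles. -/
theorem returns_of_unique {V S : Type*} [DecidableEq V] {π : V → (V → S) → ℝ}
    {t : V → S} {U : Set V}
    (h : ∀ r : V → S, (∀ v ∈ U, r v = t v) → ∀ u s, IsBestResponse π r u s ↔ s = t u)
    (r : V → S) (hr : ∀ v ∈ U, r v = t v) :
    ReturnsInOneSyncStep π r t ∧ ReturnsOnceAllMoved π r t := by
  refine ⟨⟨fun u => (h r hr u _).2 rfl, fun r' hr' => funext fun u => (h r hr u _).1 (hr' u)⟩, ?_⟩
  intro l hl
  have key : ∀ r', AsyncRun π r l r' → r' = t := fun r' hr' =>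
    hr'.eq_const_of_unique h hr ∅ (by simp) (fun v => .inr (hl v))
  obtain ⟨r', hr'⟩ := AsyncRun.exists_of_unique h l r hr
  exact ⟨key r' hr' ▸ hr', key⟩

/-! ### The torus distance -/

/-- The wrap-around distance on one coordinate. -/
def wrapDist {n : ℕ} (x y : Fin n) : ℕ :=
  min ((x : ℤ) - (y : ℤ)).natAbs (n - ((x : ℤ) - (y : ℤ)).natAbs)

theorem gridDist_eq_sum {k n : ℕ} (u v : Grid k n) :
    gridDist u v = ∑ i, wrapDist (u i) (v i) := rfl

theorem wrapDist_comm {n : ℕ} (x y : Fin n) : wrapDist x y = wrapDist y x := by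
  unfold wrapDist; rw [← Int.natAbs_neg, neg_sub]

theorem wrapDist_le {n : ℕ} (x y : Fin n) : wrapDist x y ≤ n := by
  unfold wrapDist; omega

theorem wrapDist_self {n : ℕ} (x : Fin n) : wrapDist x x = 0 := by
  simp [wrapDist]

theorem wrapDist_pos {n : ℕ} {x y : Fin n} (h : x ≠ y) : 0 < wrapDist x y := by
  have := x.2; have := y.2
  have : (x : ℕ) ≠ y := fun h' => h (Fin.ext h')
  unfold wrapDist; omega

theorem exists_wrapDist_eq_one {n : ℕ} (hn : 2 ≤ n) (x : Fin n) : ∃ y, wrapDist x y = 1 := by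
  have hx := x.2
  by_cases h : (x : ℕ) + 1 < n
  · exact ⟨⟨x + 1, h⟩, by simp only [wrapDist]; omega⟩
  · exact ⟨⟨x - 1, by omega⟩, by simp only [wrapDist]; omega⟩

theorem gridDist_comm {k n : ℕ} (u v : Grid k n) : gridDist u v = gridDist v u := by
  simp only [gridDist_eq_sum, wrapDist_comm]

theorem gridDist_le {k n : ℕ} (u v : Grid k n) : gridDist u v ≤ k * n := by
  rw [gridDist_eq_sum]
  simpa using Finset.sum_le_card_nsmul Finset.univ _ n (fun i _ => wrapDist_le (u i) (v i))

theorem wrapDist_le_gridDist {k n : ℕ} (u v : Grid k n) (i : Fin k) :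
    wrapDist (u i) (v i) ≤ gridDist u v := by
  rw [gridDist_eq_sum]
  exact Finset.single_le_sum (f := fun i => wrapDist (u i) (v i)) (fun _ _ => Nat.zero_le _)
    (Finset.mem_univ i)

theorem one_le_gridDist {k n : ℕ} {u v : Grid k n} (h : u ≠ v) : 1 ≤ gridDist u v := by
  obtain ⟨i, hi⟩ := Function.ne_iff.1 h
  exact (wrapDist_pos hi).trans_le (wrapDist_le_gridDist u v i)

theorem exists_gridDist_eq_one {k n : ℕ} (hk : 0 < k) (hn : 2 ≤ n) (u : Grid k n) :
    ∃ v, v ≠ u ∧ gridDist u v = 1 := by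
  obtain ⟨y, hy⟩ := exists_wrapDist_eq_one hn (u ⟨0, hk⟩)
  refine ⟨Function.update u ⟨0, hk⟩ y, ?_, ?_⟩
  · intro h
    have := congrFun h ⟨0, hk⟩
    rw [Function.update_self] at this
    rw [this, wrapDist_self] at hy
    omega
  · rw [gridDist_eq_sum, Finset.sum_eq_single (⟨0, hk⟩ : Fin k)]
    · simpa using hy
    · intro i _ hi
      simp [hi, wrapDist_self]
    · simp

/-! ### Sums of negative powers of the distance -/

/-- Each value `j` is taken by at most the two points `x - j` and `x + j`. -/
theorem sum_natAbs_sub_le {n : ℕ} (f : ℕ → ℝ) (hf : ∀ j, 0 ≤ f j) (x : Fin n) :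
    ∑ y : Fin n, f ((x : ℤ) - (y : ℤ)).natAbs ≤ 2 * ∑ j ∈ Finset.range n, f j := by
  rw [← Finset.sum_fiberwise_of_maps_to (s := Finset.univ) (t := Finset.range n)
    (g := fun y : Fin n => ((x : ℤ) - (y : ℤ)).natAbs)
    (by intro y _; have := x.2; have := y.2; simp only [Finset.mem_range]; omega), Finset.mul_sum]
  refine Finset.sum_le_sum fun j _ => ?_
  rw [Finset.sum_congr rfl (g := fun _ => f j)
    (by intro y hy; rw [(Finset.mem_filter.1 hy).2]), Finset.sum_const, nsmul_eq_mul]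
  refine mul_le_mul_of_nonneg_right ?_ (hf j)
  have hcard : (Finset.univ.filter fun y : Fin n => ((x : ℤ) - (y : ℤ)).natAbs = j).card
      ≤ ({(x : ℤ) - j, (x : ℤ) + j} : Finset ℤ).card := by
    refine Finset.card_le_card_of_injOn (fun y => (y : ℤ)) ?_ ?_
    · intro y hy
      simp only [Finset.coe_filter, Finset.mem_univ, true_and, Set.mem_ofPred_eq] at hy
      simp only [Finset.coe_insert, Finset.coe_singleton, Set.mem_insert_iff,
        Set.mem_singleton_iff]
      omega
    · intro y _ z _ h
      exact Fin.ext (by simpa using h)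
  exact_mod_cast hcard.trans Finset.card_le_two

theorem sum_range_inv_max_le (n : ℕ) (hn : 1 ≤ n) :
    ∑ j ∈ Finset.range n, ((max j 1 : ℕ) : ℝ)⁻¹ ≤ 2 + Real.log n := by
  obtain ⟨m, rfl⟩ : ∃ m, n = m + 1 := ⟨n - 1, by omega⟩
  rw [Finset.sum_range_succ']
  have h1 : ∑ j ∈ Finset.range m, ((max (j + 1) 1 : ℕ) : ℝ)⁻¹ = ((harmonic m : ℚ) : ℝ) := by
    rw [harmonic]; push_cast
    refine Finset.sum_congr rfl fun j _ => ?_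
    rw [max_eq_left (by linarith [(Nat.cast_nonneg j : (0 : ℝ) ≤ j)])]
  have h2 := harmonic_le_one_add_log m
  have h3 : Real.log m ≤ Real.log ((m + 1 : ℕ) : ℝ) := by
    rcases Nat.eq_zero_or_pos m with rfl | hm
    · simp
    · exact Real.log_le_log (by exact_mod_cast hm) (by push_cast; linarith)
  rw [h1]; norm_num at *; linarith

theorem sum_inv_wrapDist_le {n : ℕ} (hn : 1 ≤ n) (x : Fin n) :
    ∑ y : Fin n, ((max (wrapDist x y) 1 : ℕ) : ℝ)⁻¹ ≤ 8 * (1 + Real.log n) := by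
  have hlog : 0 ≤ Real.log n := Real.log_natCast_nonneg n
  have hb := sum_range_inv_max_le n hn
  have h1 := sum_natAbs_sub_le (fun j => ((max j 1 : ℕ) : ℝ)⁻¹) (fun j => by positivity) x
  have h2 := sum_natAbs_sub_le (fun j => ((max (n - j) 1 : ℕ) : ℝ)⁻¹) (fun j => by positivity) x
  have h3 : ∑ j ∈ Finset.range n, ((max (n - j) 1 : ℕ) : ℝ)⁻¹ ≤ 2 + Real.log n := by
    refine le_trans ?_ hb
    rw [← Finset.sum_range_reflect (fun j => ((max (n - j) 1 : ℕ) : ℝ)⁻¹)]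
    refine Finset.sum_le_sum fun j hj => ?_
    have := Finset.mem_range.1 hj
    refine inv_anti₀ (by positivity) ?_
    exact_mod_cast (by omega : max j 1 ≤ max (n - (n - 1 - j)) 1)
  -- The reciprocal of a minimum is at most the sum of the two reciprocals, which separates the
  -- direct from the wrapped distance.
  have h4 : ∑ y : Fin n, ((max (wrapDist x y) 1 : ℕ) : ℝ)⁻¹ ≤
      ∑ y : Fin n, (((max ((x : ℤ) - (y : ℤ)).natAbs 1 : ℕ) : ℝ)⁻¹ +
        ((max (n - ((x : ℤ) - (y : ℤ)).natAbs) 1 : ℕ) : ℝ)⁻¹) := by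
    refine Finset.sum_le_sum fun y _ => ?_
    unfold wrapDist
    rcases min_cases ((x : ℤ) - (y : ℤ)).natAbs (n - ((x : ℤ) - (y : ℤ)).natAbs) with h | h <;>
      rw [h.1]
    · exact le_add_of_nonneg_right (by positivity)
    · exact le_add_of_nonneg_left (by positivity)
  rw [Finset.sum_add_distrib] at h4
  linarith

/-- The bound for the sum of the `d(u, v) ^ (-k)`. -/
noncomputable def logBound (k n : ℕ) : ℝ := (8 * (1 + Real.log n)) ^ k

theorem one_le_logBound (k n : ℕ) : 1 ≤ logBound k n :=
  one_le_pow₀ (by linarith [Real.log_natCast_nonneg n])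

/-- The distance dominates each coordinate distance, so `d ^ k` dominates their product (with zeros
replaced by 1), and the sum of the product's inverse factors over coordinates into harmonic sums. -/
theorem linkNorm_le_logBound {k n : ℕ} (hn : 1 ≤ n) (u : Grid k n) :
    linkNorm u (k : ℝ) ≤ logBound k n := by
  have h1 : linkNorm u (k : ℝ) ≤
      ∑ v : Grid k n, ∏ i, ((max (wrapDist (u i) (v i)) 1 : ℕ) : ℝ)⁻¹ := by
    unfold linkNorm
    refine (Finset.sum_le_sum fun v hv => ?_).trans
      (Finset.sum_le_sum_of_subset_of_nonneg (Finset.subset_univ _)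
        fun v _ _ => Finset.prod_nonneg fun i _ => by positivity)
    have hd := one_le_gridDist (Finset.ne_of_mem_erase hv).symm
    rw [Real.rpow_neg (by positivity), Real.rpow_natCast, Finset.prod_inv_distrib]
    refine inv_anti₀ (Finset.prod_pos fun i _ => by positivity) ?_
    have := Finset.prod_le_pow_card Finset.univ
      (fun i => max (wrapDist (u i) (v i)) 1) (gridDist u v)
      (fun i _ => max_le (wrapDist_le_gridDist u v i) hd)
    rw [Finset.card_univ, Fintype.card_fin] at this
    exact_mod_cast this
  refine h1.trans ?_
  have h2 := Finset.prod_univ_sum (fun _ : Fin k => (Finset.univ : Finset (Fin n)))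
    (fun i y => ((max (wrapDist (u i) y) 1 : ℕ) : ℝ)⁻¹)
  rw [Fintype.piFinset_univ] at h2
  rw [← h2, logBound]
  have := Finset.prod_le_prod (s := Finset.univ)
    (f := fun i : Fin k => ∑ y : Fin n, ((max (wrapDist (u i) y) 1 : ℕ) : ℝ)⁻¹)
    (g := fun _ => 8 * (1 + Real.log n))
    (fun i _ => Finset.sum_nonneg fun y _ => by positivity)
    (fun i _ => sum_inv_wrapDist_le hn (u i))
  simpa using this

/-- Used with `t = s` for the normalization and with `t = k - 1` for the mean distance at strategy
`k`. -/
theorem card_mul_rpow_le_sum {k n : ℕ} (hk : 1 ≤ k) (hn : 2 ≤ n) (u : Grid k n) {t : ℝ}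
    (ht : 0 ≤ t) :
    (n : ℝ) ^ k / 2 * ((k * n : ℕ) : ℝ) ^ (-t) ≤
      ∑ v ∈ Finset.univ.erase u, (gridDist u v : ℝ) ^ (-t) := by
  have h : ∀ v ∈ Finset.univ.erase u, ((k * n : ℕ) : ℝ) ^ (-t) ≤ (gridDist u v : ℝ) ^ (-t) := by
    intro v hv
    have hd := one_le_gridDist (Finset.ne_of_mem_erase hv).symm
    exact Real.rpow_le_rpow_of_nonpos (by exact_mod_cast hd) (by exact_mod_cast gridDist_le u v)
      (by linarith)
  refine le_trans ?_ (Finset.card_nsmul_le_sum _ _ _ h)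
  rw [Finset.card_erase_of_mem (Finset.mem_univ u), nsmul_eq_mul]
  refine mul_le_mul_of_nonneg_right ?_ (by positivity)
  have hc : Finset.card (Finset.univ : Finset (Grid k n)) = n ^ k := by simp
  have h2 : 2 ≤ n ^ k := hn.trans (Nat.le_self_pow (by omega) n)
  rw [hc, Nat.cast_sub (by omega)]
  have : (2 : ℝ) ≤ (n : ℝ) ^ k := by exact_mod_cast h2
  push_cast; linarith

theorem one_le_linkNorm {k n : ℕ} (hk : 1 ≤ k) (hn : 2 ≤ n) (u : Grid k n) (s : ℝ) :
    1 ≤ linkNorm u s := by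
  obtain ⟨v, hv, hd⟩ := exists_gridDist_eq_one hk hn u
  have := Finset.single_le_sum (s := Finset.univ.erase u)
    (f := fun v => (gridDist u v : ℝ) ^ (-s)) (fun v _ => by positivity)
    (Finset.mem_erase.2 ⟨hv, Finset.mem_univ v⟩)
  rw [hd, Nat.cast_one, Real.one_rpow] at this
  exact this

/-! ### Bounds for the payoffs -/

theorem strategySet_nonneg {γ : ℝ} (hγ : 0 ≤ γ) (s : strategySet γ) : 0 ≤ (s : ℝ) := by
  obtain ⟨m, hm⟩ := s.2
  rw [hm]; positivity

theorem strategySet_gap {γ : ℝ} {g : ℕ} (hg : 2 ≤ g) (hγ : γ = 1 / (g : ℝ)) (k : ℕ)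
    (s : strategySet γ) (hs : (s : ℝ) ≠ k) : (s : ℝ) ≤ k - γ ∨ k + γ ≤ (s : ℝ) := by
  obtain ⟨m, hm⟩ := s.2
  have hg0 : (0 : ℝ) < g := by exact_mod_cast (by omega : 0 < g)
  have hγ0 : 0 < γ := by rw [hγ]; positivity
  have hk : (k : ℝ) = (k * g : ℕ) * γ := by rw [hγ]; push_cast; field_simp
  rw [hm, hk]
  rcases lt_trichotomy m (k * g) with h | h | h
  · left
    have : ((m + 1 : ℕ) : ℝ) ≤ (k * g : ℕ) := by exact_mod_cast h
    push_cast at *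
    nlinarith
  · exact absurd (by rw [hm, hk, h]) hs
  · right
    have : ((k * g + 1 : ℕ) : ℝ) ≤ m := by exact_mod_cast h
    push_cast at *
    nlinarith

theorem linkProb_nonneg {k n : ℕ} (u v : Grid k n) (s : ℝ) : 0 ≤ linkProb u v s := by
  unfold linkProb linkNorm
  exact div_nonneg (by positivity) (Finset.sum_nonneg fun _ _ => by positivity)

theorem sum_linkProb {k n : ℕ} (hk : 1 ≤ k) (hn : 2 ≤ n) (u : Grid k n) (s : ℝ) :
    ∑ v ∈ Finset.univ.erase u, linkProb u v s = 1 := by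
  have := one_le_linkNorm hk hn u s
  unfold linkProb
  rw [← Finset.sum_div]
  exact div_self (show linkNorm u s ≠ 0 by linarith)

theorem linkProb_le_one {k n : ℕ} (hk : 1 ≤ k) (hn : 2 ≤ n) {u v : Grid k n} (h : u ≠ v) (s : ℝ) :
    linkProb u v s ≤ 1 := by
  rw [← sum_linkProb hk hn u s]
  exact Finset.single_le_sum (f := fun v => linkProb u v s) (fun v _ => linkProb_nonneg u v s)
    (Finset.mem_erase.2 ⟨h.symm, Finset.mem_univ v⟩)

/-- For `s ≥ k` the normalization is at least 1. For `s ≤ k` it is at least of order `(k * n) ^ (k -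
s)`, which absorbs the excess `d ^ (k - s)`. Uniformity in `s` is what tolerates arbitrary perturbed
strategies. -/
theorem linkProb_le {k n : ℕ} (hk : 1 ≤ k) (hn : 2 ≤ n) {u v : Grid k n} (h : u ≠ v) {s : ℝ}
    (hs : 0 ≤ s) : linkProb u v s ≤ 2 * (k : ℝ) ^ k * (gridDist u v : ℝ) ^ (-(k : ℝ)) := by
  have hd : (1 : ℝ) ≤ gridDist u v := by exact_mod_cast one_le_gridDist h
  have hd0 : (0 : ℝ) < gridDist u v := by linarith
  have hc := one_le_linkNorm hk hn u s
  have hk1 : (1 : ℝ) ≤ (k : ℝ) ^ k := one_le_pow₀ (by exact_mod_cast hk)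
  have hN : (gridDist u v : ℝ) ≤ (k * n : ℕ) := by exact_mod_cast gridDist_le u v
  have hN0 : (0 : ℝ) < (k * n : ℕ) := by linarith
  unfold linkProb
  rw [div_le_iff₀ (by linarith)]
  rcases le_total (k : ℝ) s with hks | hks
  · calc (gridDist u v : ℝ) ^ (-s) ≤ 1 * (gridDist u v : ℝ) ^ (-(k : ℝ)) * 1 := by
          rw [one_mul, mul_one]
          exact Real.rpow_le_rpow_of_exponent_le hd (by linarith)
      _ ≤ _ := by gcongr; linarith
  · have h1 := card_mul_rpow_le_sum hk hn u hs
    have h2 : (gridDist u v : ℝ) ^ (-s) ≤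
        (gridDist u v : ℝ) ^ (-(k : ℝ)) * (((k * n : ℕ) : ℝ) ^ k * ((k * n : ℕ) : ℝ) ^ (-s)) := by
      rw [← Real.rpow_natCast ((k * n : ℕ) : ℝ) k, ← Real.rpow_add hN0,
        show -s = -(k : ℝ) + (k + -s) by ring, Real.rpow_add hd0, neg_add_cancel_left]
      gcongr
      linarith
    refine h2.trans ?_
    calc _ = 2 * (k : ℝ) ^ k * (gridDist u v : ℝ) ^ (-(k : ℝ)) *
          ((n : ℝ) ^ k / 2 * ((k * n : ℕ) : ℝ) ^ (-s)) := by push_cast; ring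
      _ ≤ _ := by gcongr; exact h1

/-- The mean distance is trivially at most `k * n`; the gain `n ^ (-γ)` comes from the normalization
in the reciprocity, which is at least of order `n ^ γ`. -/
theorem drbPayoff_le_of_le {k n : ℕ} (hk : 1 ≤ k) (hn : 2 ≤ n) {γ : ℝ} (hγ : 0 ≤ γ)
    (u : Grid k n) (r : Grid k n → strategySet γ) (hr : (r u : ℝ) ≤ k - γ) :
    drbPayoff γ u r ≤ 4 * (k : ℝ) ^ (2 * k + 1) * logBound k n * (n : ℝ) ^ (1 - γ) := by
  have hs := strategySet_nonneg hγ (r u)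
  set s : ℝ := (r u).1 with hsdef
  have hn0 : (0 : ℝ) < n := by exact_mod_cast (by omega : 0 < n)
  have hk0 : (1 : ℝ) ≤ k := by exact_mod_cast hk
  have hc := one_le_linkNorm hk hn u s
  have hN0 : (0 : ℝ) < (k * n : ℕ) := by exact_mod_cast Nat.mul_pos hk (by omega)
  have hΛ := one_le_logBound k n
  have h1 : ∑ v ∈ Finset.univ.erase u, linkProb u v s * (gridDist u v : ℝ) ≤ (k * n : ℕ) := by
    calc _ ≤ ∑ v ∈ Finset.univ.erase u, linkProb u v s * ((k * n : ℕ) : ℝ) :=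
          Finset.sum_le_sum fun v _ => mul_le_mul_of_nonneg_left
            (by exact_mod_cast gridDist_le u v) (linkProb_nonneg u v s)
      _ = _ := by rw [← Finset.sum_mul, sum_linkProb hk hn, one_mul]
  have h2 : ∑ v ∈ Finset.univ.erase u, linkProb u v s * linkProb v u (r v) ≤
      2 * (k : ℝ) ^ k * logBound k n / linkNorm u s := by
    calc _ ≤ ∑ v ∈ Finset.univ.erase u,
          1 / linkNorm u s * (2 * (k : ℝ) ^ k * (gridDist u v : ℝ) ^ (-(k : ℝ))) := by
          refine Finset.sum_le_sum fun v hv => ?_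
          have hvu := Finset.ne_of_mem_erase hv
          have hd : (1 : ℝ) ≤ gridDist u v := by exact_mod_cast one_le_gridDist hvu.symm
          have := linkProb_le hk hn hvu (strategySet_nonneg hγ (r v))
          rw [gridDist_comm v u] at this
          refine mul_le_mul ?_ this (linkProb_nonneg _ _ _) (by positivity)
          unfold linkProb
          gcongr
          exact Real.rpow_le_one_of_one_le_of_nonpos hd (by linarith)
      _ = 2 * (k : ℝ) ^ k * linkNorm u k / linkNorm u s := by
          rw [← Finset.mul_sum, ← Finset.mul_sum]
          change 1 / linkNorm u s * (2 * (k : ℝ) ^ k * linkNorm u k) = _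
          ring
      _ ≤ _ := by gcongr; exact linkNorm_le_logBound (by omega) u
  have h3 : 1 / linkNorm u s ≤ 2 * (k : ℝ) ^ k * (n : ℝ) ^ (-γ) := by
    have hcl : (n : ℝ) ^ k / 2 * ((k * n : ℕ) : ℝ) ^ (-s) ≤ linkNorm u s :=
      card_mul_rpow_le_sum hk hn u hs
    rw [div_le_iff₀ (by linarith)]
    refine le_trans ?_ (mul_le_mul_of_nonneg_left hcl (by positivity))
    have e1 : ((k * n : ℕ) : ℝ) ^ k * ((k * n : ℕ) : ℝ) ^ (-s) = ((k * n : ℕ) : ℝ) ^ (k - s) := by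
      rw [← Real.rpow_natCast ((k * n : ℕ) : ℝ) k, ← Real.rpow_add hN0, sub_eq_add_neg]
    calc (1 : ℝ) = (n : ℝ) ^ γ * (n : ℝ) ^ (-γ) := by
          rw [← Real.rpow_add hn0, add_neg_cancel, Real.rpow_zero]
      _ ≤ ((k * n : ℕ) : ℝ) ^ (k - s) * (n : ℝ) ^ (-γ) := by
          gcongr
          calc (n : ℝ) ^ γ ≤ ((k * n : ℕ) : ℝ) ^ γ := by
                gcongr
                exact_mod_cast Nat.le_mul_of_pos_left n hk
            _ ≤ _ := Real.rpow_le_rpow_of_exponent_le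
                (by exact_mod_cast Nat.mul_pos hk (by omega)) (by linarith)
      _ = _ := by rw [← e1]; push_cast; ring
  have h4 : (n : ℝ) ^ (1 - γ) = n * (n : ℝ) ^ (-γ) := by
    rw [sub_eq_add_neg, Real.rpow_add hn0, Real.rpow_one]
  calc drbPayoff γ u r ≤ (k * n : ℕ) * (2 * (k : ℝ) ^ k * logBound k n / linkNorm u s) :=
        mul_le_mul h1 h2 (Finset.sum_nonneg fun v _ =>
          mul_nonneg (linkProb_nonneg _ _ _) (linkProb_nonneg _ _ _)) hN0.le
    _ = (k * n : ℕ) * (2 * (k : ℝ) ^ k * logBound k n) * (1 / linkNorm u s) := by ring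
    _ ≤ (k * n : ℕ) * (2 * (k : ℝ) ^ k * logBound k n) * (2 * (k : ℝ) ^ k * (n : ℝ) ^ (-γ)) := by
        gcongr
    _ = _ := by rw [h4]; push_cast; ring

/-- Here reciprocity is bounded by 1, and the gain comes from the mean distance, since `d ^ (1 - s)
≤ d ^ (1 - γ) * d ^ (-k)`. -/
theorem drbPayoff_le_of_ge {k n : ℕ} (hk : 1 ≤ k) (hn : 2 ≤ n) {γ : ℝ} (hγ : 0 ≤ γ) (hγ1 : γ ≤ 1)
    (u : Grid k n) (r : Grid k n → strategySet γ) (hr : k + γ ≤ (r u : ℝ)) :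
    drbPayoff γ u r ≤ 4 * (k : ℝ) ^ (2 * k + 1) * logBound k n * (n : ℝ) ^ (1 - γ) := by
  set s : ℝ := (r u).1 with hsdef
  have hk0 : (1 : ℝ) ≤ k := by exact_mod_cast hk
  have hc := one_le_linkNorm hk hn u s
  have hΛ := one_le_logBound k n
  have h1 : ∑ v ∈ Finset.univ.erase u, linkProb u v s * (gridDist u v : ℝ) ≤
      (k * n : ℕ) ^ (1 - γ) * logBound k n := by
    calc _ ≤ ∑ v ∈ Finset.univ.erase u,
          ((k * n : ℕ) : ℝ) ^ (1 - γ) * (gridDist u v : ℝ) ^ (-(k : ℝ)) := by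
          refine Finset.sum_le_sum fun v hv => ?_
          have hvu := Finset.ne_of_mem_erase hv
          have hd : (1 : ℝ) ≤ gridDist u v := by exact_mod_cast one_le_gridDist hvu.symm
          have hN : (gridDist u v : ℝ) ≤ (k * n : ℕ) := by exact_mod_cast gridDist_le u v
          calc linkProb u v s * (gridDist u v : ℝ)
              ≤ (gridDist u v : ℝ) ^ (-s) * (gridDist u v : ℝ) := by
                unfold linkProb
                gcongr
                exact div_le_self (by positivity) hc
            _ = (gridDist u v : ℝ) ^ (-s + 1) := by
                rw [Real.rpow_add_one (by linarith)]
            _ ≤ (gridDist u v : ℝ) ^ ((1 - γ) + -(k : ℝ)) :=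
                Real.rpow_le_rpow_of_exponent_le hd (by linarith)
            _ = (gridDist u v : ℝ) ^ (1 - γ) * (gridDist u v : ℝ) ^ (-(k : ℝ)) :=
                Real.rpow_add (by linarith) _ _
            _ ≤ _ := by gcongr
      _ = (k * n : ℕ) ^ (1 - γ) * linkNorm u k := by rw [← Finset.mul_sum]; rfl
      _ ≤ _ := by gcongr; exact linkNorm_le_logBound (by omega) u
  have h2 : ∑ v ∈ Finset.univ.erase u, linkProb u v s * linkProb v u (r v) ≤ 1 := by
    rw [← sum_linkProb hk hn u s]
    exact Finset.sum_le_sum fun v hv => mul_le_of_le_one_right (linkProb_nonneg _ _ _)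
      (linkProb_le_one hk hn (Finset.ne_of_mem_erase hv) _)
  -- A crude constant, so that both ranges of strategies share one bound.
  have hkγ : (k : ℝ) ^ (1 - γ) ≤ 4 * (k : ℝ) ^ (2 * k + 1) := by
    calc (k : ℝ) ^ (1 - γ) ≤ (k : ℝ) ^ ((2 * k + 1 : ℕ) : ℝ) :=
          Real.rpow_le_rpow_of_exponent_le hk0 (by push_cast; linarith)
      _ = (k : ℝ) ^ (2 * k + 1) := Real.rpow_natCast _ _
      _ ≤ _ := by linarith [show 0 < (k : ℝ) ^ (2 * k + 1) by positivity]
  calc drbPayoff γ u r ≤ ((k * n : ℕ) ^ (1 - γ) * logBound k n) * 1 :=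
        mul_le_mul h1 h2 (Finset.sum_nonneg fun v _ =>
          mul_nonneg (linkProb_nonneg _ _ _) (linkProb_nonneg _ _ _)) (by positivity)
    _ = (k : ℝ) ^ (1 - γ) * logBound k n * (n : ℝ) ^ (1 - γ) := by
        push_cast
        rw [Real.mul_rpow (by positivity) (by positivity)]; ring
    _ ≤ _ := by gcongr

/-- The mean distance costs one logarithmic factor; the single mutual link with `v` costs `R ^ k`
and one such factor in each direction. -/
theorem le_drbPayoff {k n : ℕ} (hk : 1 ≤ k) (hn : 2 ≤ n) {γ : ℝ}
    (u : Grid k n) (r : Grid k n → strategySet γ) (hr : (r u : ℝ) = k) {R : ℕ}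
    (hR : ∃ v, v ≠ u ∧ gridDist u v ≤ R ∧ (r v : ℝ) = k) :
    n / (2 * (k : ℝ) ^ k * logBound k n ^ 3 * (R : ℝ) ^ (2 * k)) ≤ drbPayoff γ u r := by
  obtain ⟨v, hvu, hvR, hv⟩ := hR
  have hk0 : (1 : ℝ) ≤ k := by exact_mod_cast hk
  have hn0 : (0 : ℝ) < n := by exact_mod_cast (by omega : 0 < n)
  have hΛ := one_le_logBound k n
  have hcu := one_le_linkNorm hk hn u k
  have hcv := one_le_linkNorm hk hn v k
  have hcu' := linkNorm_le_logBound (by omega) u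
  have hcv' := linkNorm_le_logBound (by omega) v
  have hd1 := one_le_gridDist hvu.symm
  have hd : (0 : ℝ) < gridDist u v := by exact_mod_cast hd1
  have hR0 : (0 : ℝ) < R := by exact_mod_cast hd1.trans hvR
  have hN0 : (0 : ℝ) < (k * n : ℕ) := by exact_mod_cast Nat.mul_pos hk (by omega)
  have h1 : n / (2 * (k : ℝ) ^ k * logBound k n) ≤
      ∑ v ∈ Finset.univ.erase u, linkProb u v (r u) * (gridDist u v : ℝ) := by
    have e : ∑ v ∈ Finset.univ.erase u, linkProb u v (r u) * (gridDist u v : ℝ) =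
        (∑ v ∈ Finset.univ.erase u, (gridDist u v : ℝ) ^ (-((k : ℝ) - 1))) / linkNorm u k := by
      rw [Finset.sum_div, hr]
      refine Finset.sum_congr rfl fun v hv => ?_
      have : (gridDist u v : ℝ) ≠ 0 := by
        exact_mod_cast (Nat.pos_iff_ne_zero.1 (one_le_gridDist (Finset.ne_of_mem_erase hv).symm))
      rw [linkProb, neg_sub, sub_eq_neg_add, Real.rpow_add_one this]
      ring
    rw [e]
    have hs := card_mul_rpow_le_sum hk hn u (t := (k : ℝ) - 1) (by linarith)
    have e2 : (n : ℝ) / (2 * (k : ℝ) ^ k) ≤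
        (n : ℝ) ^ k / 2 * ((k * n : ℕ) : ℝ) ^ (-((k : ℝ) - 1)) := by
      rw [neg_sub, sub_eq_neg_add, Real.rpow_add_one hN0.ne', Real.rpow_neg hN0.le,
        Real.rpow_natCast]
      push_cast
      rw [mul_pow]
      have : (n : ℝ) ^ k / 2 * (((k : ℝ) ^ k * (n : ℝ) ^ k)⁻¹ * (k * n)) =
        n / (2 * (k : ℝ) ^ k) * k := by field_simp
      rw [this]
      exact le_mul_of_one_le_right (by positivity) hk0
    rw [← div_div]
    exact div_le_div₀ (by linarith [show (0 : ℝ) ≤ n / (2 * (k : ℝ) ^ k) by positivity])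
      (e2.trans hs) (by linarith) hcu'
  have h2 : 1 / (logBound k n ^ 2 * (R : ℝ) ^ (2 * k)) ≤
      ∑ v ∈ Finset.univ.erase u, linkProb u v (r u) * linkProb v u (r v) := by
    refine le_trans ?_ (Finset.single_le_sum
      (f := fun v => linkProb u v (r u) * linkProb v u (r v))
      (fun v _ => mul_nonneg (linkProb_nonneg _ _ _) (linkProb_nonneg _ _ _))
      (Finset.mem_erase.2 ⟨hvu, Finset.mem_univ v⟩))
    have hp : 1 / (logBound k n * (R : ℝ) ^ k) ≤ (gridDist u v : ℝ) ^ (-(k : ℝ)) / logBound k n := by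
      rw [Real.rpow_neg hd.le, Real.rpow_natCast, one_div, mul_inv, mul_comm, div_eq_mul_inv]
      gcongr
    simp only [hr, hv]
    calc 1 / (logBound k n ^ 2 * (R : ℝ) ^ (2 * k))
        = 1 / (logBound k n * (R : ℝ) ^ k) * (1 / (logBound k n * (R : ℝ) ^ k)) := by
          rw [one_div_mul_one_div]; ring_nf
      _ ≤ _ := by
          refine mul_le_mul (hp.trans ?_) (hp.trans ?_) (by positivity) (linkProb_nonneg _ _ _)
          · unfold linkProb; gcongr
          · unfold linkProb; rw [gridDist_comm v u]; gcongr
  calc _ = n / (2 * (k : ℝ) ^ k * logBound k n) * (1 / (logBound k n ^ 2 * (R : ℝ) ^ (2 * k))) := by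
        rw [div_mul_div_comm]; ring_nf
    _ ≤ drbPayoff γ u r := mul_le_mul h1 h2 (by positivity) (le_trans (by positivity) h1)

/-! ### Boxes around a node -/

theorem exists_interval {n L : ℕ} (hL : L ≤ n) (x : Fin n) :
    ∃ B : Finset (Fin n), B.card = L ∧ ∀ y ∈ B, wrapDist x y ≤ L := by
  have hx := x.2
  -- Starting at `min x (n - L)` keeps the interval inside the range, without wrapping.
  refine ⟨Finset.univ.map ⟨fun j : Fin L => ⟨min x.1 (n - L) + j, by omega⟩, fun i j h => ?_⟩,
    by simp, ?_⟩
  · have := Fin.mk.inj h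
    exact Fin.ext (by omega)
  · intro y hy
    obtain ⟨j, -, rfl⟩ := Finset.mem_map.1 hy
    have hj := j.2
    refine (min_le_left _ _).trans ?_
    change ((x : ℤ) - ((min x.1 (n - L) + j : ℕ) : ℤ)).natAbs ≤ L
    omega

theorem exists_box {k n L : ℕ} (hL : L ≤ n) (u : Grid k n) :
    ∃ B : Finset (Grid k n), L ^ k - 1 ≤ B.card ∧ ∀ v ∈ B, v ≠ u ∧ gridDist u v ≤ k * L := by
  choose B hB hd using fun i => exists_interval hL (u i)
  refine ⟨(Fintype.piFinset B).erase u, ?_, fun v hv => ⟨Finset.ne_of_mem_erase hv, ?_⟩⟩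
  · refine le_trans ?_ Finset.pred_card_le_card_erase
    simp [Fintype.card_piFinset, hB]
  · have hv' := Fintype.mem_piFinset.1 (Finset.mem_of_mem_erase hv)
    rw [gridDist_eq_sum]
    simpa using Finset.sum_le_card_nsmul Finset.univ _ L (fun i _ => hd i (v i) (hv' i))

/-! ### Asymptotics -/

open Filter in
theorem eventually_log_pow_lt_rpow (C : ℝ) (m : ℕ) {δ : ℝ} (hδ : 0 < δ) :
    ∀ᶠ n : ℕ in atTop, C * (1 + Real.log n) ^ m < (n : ℝ) ^ δ := by
  -- The exponent `m + 1` makes `IsLittleO.pow` applicable also when `m = 0`.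
  have h1 : (fun x : ℝ => (1 + Real.log x) ^ (m + 1)) =o[atTop]
      fun x : ℝ => (x ^ (δ / (m + 1 : ℕ))) ^ (m + 1) := by
    refine Asymptotics.IsLittleO.pow ?_ (Nat.succ_pos m)
    have hp : 0 < δ / (m + 1 : ℕ) := by positivity
    refine Asymptotics.IsLittleO.add ?_ (isLittleO_log_rpow_atTop hp)
    rw [Asymptotics.isLittleO_const_left]
    exact .inr (tendsto_norm_atTop_atTop.comp (tendsto_rpow_atTop hp))
  have h2 := h1.def (show 0 < 1 / (|C| + 1) by positivity)
  filter_upwards [tendsto_natCast_atTop_atTop.eventually h2, eventually_ge_atTop 1] with n hn hn1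
  have hlog := Real.log_natCast_nonneg n
  have hn0 : (0 : ℝ) < n := by exact_mod_cast hn1
  have e : ((n : ℝ) ^ (δ / (m + 1 : ℕ))) ^ (m + 1) = (n : ℝ) ^ δ := by
    rw [← Real.rpow_natCast, ← Real.rpow_mul hn0.le, div_mul_cancel₀ _ (by positivity)]
  rw [e, Real.norm_of_nonneg (by positivity), Real.norm_of_nonneg (by positivity),
    div_mul_eq_mul_div, one_mul, le_div_iff₀ (by positivity)] at hn
  have h3 : 1 ≤ (1 + Real.log n) ^ m := one_le_pow₀ (by linarith)
  have h4 : (1 + Real.log n) ^ m ≤ (1 + Real.log n) ^ (m + 1) :=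
    pow_le_pow_right₀ (by linarith) (Nat.le_succ m)
  nlinarith [le_abs_self C, abs_nonneg C]

/-- The side length of the boxes in which an unperturbed node is sought. -/
noncomputable def boxSide (k : ℕ) (γ : ℝ) (n : ℕ) : ℕ := ⌈(n : ℝ) ^ (γ / (3 * k))⌉₊

theorem boxSide_le {k n : ℕ} (hk : 1 ≤ k) (hn : 1 ≤ n) {γ : ℝ} (hγ1 : γ ≤ 1) :
    boxSide k γ n ≤ n := by
  have hk0 : (1 : ℝ) ≤ k := by exact_mod_cast hk
  refine Nat.ceil_le.2 ?_
  calc (n : ℝ) ^ (γ / (3 * k)) ≤ (n : ℝ) ^ (1 : ℝ) :=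
        Real.rpow_le_rpow_of_exponent_le (by exact_mod_cast hn)
          ((div_le_one (by positivity)).2 (by linarith))
    _ = n := Real.rpow_one _

theorem rpow_boxSide_exponent {k n : ℕ} (hk : 1 ≤ k) (γ : ℝ) :
    ((n : ℝ) ^ (γ / (3 * k))) ^ k = (n : ℝ) ^ (γ / 3) := by
  have : (k : ℝ) ≠ 0 := by exact_mod_cast (by omega : k ≠ 0)
  rw [← Real.rpow_natCast, ← Real.rpow_mul (by positivity)]
  congr 1
  field_simp

theorem le_boxSide_pow {k n : ℕ} (hk : 1 ≤ k) (γ : ℝ) :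
    (n : ℝ) ^ (γ / 3) ≤ (boxSide k γ n : ℝ) ^ k := by
  rw [← rpow_boxSide_exponent hk]
  gcongr
  exact Nat.le_ceil _

theorem boxSide_pow_le {k n : ℕ} (hk : 1 ≤ k) (hn : 1 ≤ n) {γ : ℝ} (hγ : 0 ≤ γ) :
    (boxSide k γ n : ℝ) ^ k ≤ 2 ^ k * (n : ℝ) ^ (γ / 3) := by
  rw [← rpow_boxSide_exponent hk, ← mul_pow]
  gcongr
  have h1 : (1 : ℝ) ≤ (n : ℝ) ^ (γ / (3 * k)) :=
    Real.one_le_rpow (by exact_mod_cast hn) (by positivity)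
  have := Nat.ceil_lt_add_one (show 0 ≤ (n : ℝ) ^ (γ / (3 * k)) by positivity)
  unfold boxSide
  linarith

open Filter in
-- The factor `R ^ (2 * k)` costs `n ^ (2γ/3)` of the advantage `n ^ γ`; the remaining `n ^ (γ/3)`
-- beats the fourth power of `logBound`.
theorem eventually_payoff_gap {k : ℕ} (hk : 1 ≤ k) {γ : ℝ} (hγ : 0 < γ) :
    ∀ᶠ n : ℕ in atTop, 4 * (k : ℝ) ^ (2 * k + 1) * logBound k n * (n : ℝ) ^ (1 - γ) <
      n / (2 * (k : ℝ) ^ k * logBound k n ^ 3 * ((k * boxSide k γ n : ℕ) : ℝ) ^ (2 * k)) := by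
  have hk0 : (1 : ℝ) ≤ k := by exact_mod_cast hk
  filter_upwards [eventually_log_pow_lt_rpow
    (8 * (k : ℝ) ^ (5 * k + 1) * 4 ^ k * 8 ^ (4 * k)) (4 * k) (show 0 < γ / 3 by positivity),
    eventually_ge_atTop 1] with n hn hn1
  have hn0 : (0 : ℝ) < n := by exact_mod_cast hn1
  have hΛ := one_le_logBound k n
  have hL0 : 0 < boxSide k γ n := Nat.ceil_pos.2 (by positivity)
  have hL := boxSide_pow_le hk hn1 hγ.le
  have hΛ4 : logBound k n ^ 4 = 8 ^ (4 * k) * (1 + Real.log n) ^ (4 * k) := by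
    rw [logBound, ← pow_mul, mul_comm k 4, mul_pow]
  rw [lt_div_iff₀ (by positivity)]
  calc _ = 8 * (k : ℝ) ^ (5 * k + 1) * logBound k n ^ 4 * (n : ℝ) ^ (1 - γ) *
        ((boxSide k γ n : ℝ) ^ k) ^ 2 := by push_cast; ring
    _ ≤ 8 * (k : ℝ) ^ (5 * k + 1) * logBound k n ^ 4 * (n : ℝ) ^ (1 - γ) *
        (2 ^ k * (n : ℝ) ^ (γ / 3)) ^ 2 := by gcongr
    _ = 8 * (k : ℝ) ^ (5 * k + 1) * 4 ^ k * 8 ^ (4 * k) * (1 + Real.log n) ^ (4 * k) *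
        ((n : ℝ) ^ (1 - γ) * (n : ℝ) ^ (γ / 3) * (n : ℝ) ^ (γ / 3)) := by
        rw [hΛ4, show (4 : ℝ) ^ k = 2 ^ k * 2 ^ k by rw [← mul_pow]; norm_num]; ring
    _ < (n : ℝ) ^ (γ / 3) * ((n : ℝ) ^ (1 - γ) * (n : ℝ) ^ (γ / 3) * (n : ℝ) ^ (γ / 3)) := by
        gcongr
    _ = n := by
        rw [← Real.rpow_add hn0, ← Real.rpow_add hn0, ← Real.rpow_add hn0]
        ring_nf
        exact Real.rpow_one _

open Filter in
theorem eventually_union_bound {k : ℕ} (hk : 1 ≤ k) {γ ε : ℝ} (hε0 : 0 < ε) (hε : ε < γ / 4) :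
    ∀ᶠ n : ℕ in atTop,
      (n : ℝ) ^ k * Real.exp (-(n : ℝ) ^ (-ε)) ^ (boxSide k γ n ^ k - 1) ≤ 1 / n := by
  filter_upwards [eventually_log_pow_lt_rpow (k + 1) 1 (show 0 < γ / 3 - ε by linarith),
    eventually_ge_atTop 1] with n hn hn1
  have hn0 : (0 : ℝ) < n := by exact_mod_cast hn1
  have hL0 : 0 < boxSide k γ n := Nat.ceil_pos.2 (by positivity)
  have hL := le_boxSide_pow (n := n) hk γ
  have hx : (n : ℝ) ^ (-ε) ≤ 1 :=
    Real.rpow_le_one_of_one_le_of_nonpos (by exact_mod_cast hn1) (by linarith)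
  have hx0 : 0 < (n : ℝ) ^ (-ε) := by positivity
  -- Of the `k + 1` logarithms, `k` pay for the union over all nodes and one for the target `1 / n`.
  -- The `-1` in the box size costs at most 1.
  have key : (k + 1) * Real.log n ≤ ((boxSide k γ n ^ k - 1 : ℕ) : ℝ) * (n : ℝ) ^ (-ε) := by
    rw [Nat.cast_sub (Nat.one_le_pow _ _ hL0)]
    push_cast
    have e : (n : ℝ) ^ (γ / 3 - ε) = (n : ℝ) ^ (γ / 3) * (n : ℝ) ^ (-ε) := by
      rw [sub_eq_add_neg, Real.rpow_add hn0]
    have := mul_le_mul_of_nonneg_right hL hx0.le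
    rw [e, pow_one] at hn
    have hk0 : (0 : ℝ) ≤ k := Nat.cast_nonneg k
    nlinarith
  have e1 : (n : ℝ) ^ k = Real.exp (k * Real.log n) := by
    rw [Real.exp_nat_mul, Real.exp_log hn0]
  have e2 : 1 / (n : ℝ) = Real.exp (-Real.log n) := by
    rw [Real.exp_neg, Real.exp_log hn0, one_div]
  rw [e1, e2, ← Real.exp_nat_mul, ← Real.exp_add]
  exact Real.exp_le_exp.2 (by linarith)

/-! ### The dynamic -/

/-- If every node has a close unperturbed node, `k` is the unique best response of every node. -/
theorem isBestResponse_iff_navigable {k n : ℕ} (hk : 1 ≤ k) (hn : 2 ≤ n) {g : ℕ} (hg : 2 ≤ g)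
    {γ : ℝ} (hγ : γ = 1 / (g : ℝ)) {R : ℕ}
    (hgap : 4 * (k : ℝ) ^ (2 * k + 1) * logBound k n * (n : ℝ) ^ (1 - γ) <
      n / (2 * (k : ℝ) ^ k * logBound k n ^ 3 * (R : ℝ) ^ (2 * k)))
    {U : Set (Grid k n)} (hU : ∀ u, ∃ v ∈ U, v ≠ u ∧ gridDist u v ≤ R)
    (r : Grid k n → strategySet γ) (hr : ∀ v ∈ U, r v = navigableProfile hg hγ k n v)
    (u : Grid k n) (s : strategySet γ) :
    IsBestResponse (drbPayoff γ) r u s ↔ s = navigableProfile hg hγ k n u := by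
  have hg2 : (2 : ℝ) ≤ g := by exact_mod_cast hg
  have hγ0 : 0 ≤ γ := by rw [hγ]; positivity
  have hγ1 : γ ≤ 1 := by rw [hγ, div_le_one (by linarith)]; linarith
  obtain ⟨v, hvU, hvu, hvR⟩ := hU u
  have hlow := le_drbPayoff hk hn u (Function.update r u (navigableProfile hg hγ k n u))
    (by rw [Function.update_self]; rfl) ⟨v, hvu, hvR, by
      rw [Function.update_of_ne hvu, hr v hvU]; rfl⟩
  have hlt : ∀ s : strategySet γ, s ≠ navigableProfile hg hγ k n u →
      drbPayoff γ u (Function.update r u s) <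
        drbPayoff γ u (Function.update r u (navigableProfile hg hγ k n u)) := by
    intro s hs
    refine lt_of_le_of_lt ?_ (hgap.trans_le hlow)
    rcases strategySet_gap hg hγ k s (fun h => hs (Subtype.ext h)) with h | h
    · exact drbPayoff_le_of_le hk hn hγ0 u _ (by rwa [Function.update_self])
    · exact drbPayoff_le_of_ge hk hn hγ0 hγ1 u _ (by rwa [Function.update_self])
  constructor
  · intro h
    by_contra hs
    exact absurd (h (navigableProfile hg hγ k n u)) (not_le.2 (hlt s hs))
  · rintro rfl s'
    by_cases hs : s' = navigableProfile hg hγ k n u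
    · rw [hs]
    · exact (hlt s' hs).le

/-- The probability that some set `B u` with at least `m` elements consists of perturbed nodes
only. -/
theorem measureReal_iUnion_biInter_le {V Ω : Type*} [Fintype V] [MeasurableSpace Ω]
    (P : MeasureTheory.Measure Ω) {D : V → Set Ω}
    (hD : ∀ u, MeasurableSet (D u)) (hind : ProbabilityTheory.iIndepSet D P) {x : ℝ} (hx : 0 ≤ x)
    (hp : ∀ u, P.real (D u) ≤ 1 - x) (B : V → Finset V) {m : ℕ} (hB : ∀ u, m ≤ (B u).card) :
    P.real (⋃ u, ⋂ v ∈ B u, D v) ≤ Fintype.card V * Real.exp (-x) ^ m := by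
  refine (MeasureTheory.measureReal_iUnion_fintype_le _).trans ?_
  have h : ∀ u ∈ Finset.univ, P.real (⋂ v ∈ B u, D v) ≤ Real.exp (-x) ^ m := by
    intro u _
    have hm := (ProbabilityTheory.iIndepSet_iff_meas_biInter hD).1 hind (B u)
    rw [MeasureTheory.measureReal_def, hm, ENNReal.toReal_prod]
    calc _ ≤ ∏ _v ∈ B u, Real.exp (-x) :=
          Finset.prod_le_prod (fun _ _ => ENNReal.toReal_nonneg) fun v _ =>
            (hp v).trans (Real.one_sub_le_exp_neg x)
      _ = Real.exp (-x) ^ (B u).card := Finset.prod_const _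
      _ ≤ _ := pow_le_pow_of_le_one (Real.exp_pos _).le (Real.exp_le_one_iff.2 (by linarith)) (hB u)
  simpa using Finset.sum_le_card_nsmul _ _ _ h

theorem mainTheorem7 (k : ℕ) (hk : 1 < k) (g : ℕ) (hg : 2 ≤ g) (γ : ℝ) (hγ : γ = 1 / (g : ℝ))
    (ε : ℝ) (hε0 : 0 < ε) (hε : ε < γ / 4) :
    ∃ n₀ : ℕ, ∀ n : ℕ, n₀ ≤ n →
      ∀ p : Grid k n → ℝ, (∀ u, p u ≤ 1 - (n : ℝ) ^ (-ε)) →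
      ∀ (Ω : Type*) [MeasurableSpace Ω] (P : MeasureTheory.Measure Ω)
        [MeasureTheory.IsProbabilityMeasure P] (D : Grid k n → Set Ω),
        (∀ u, MeasurableSet (D u)) → ProbabilityTheory.iIndepSet D P →
        (∀ u, P.real (D u) = p u) →
        1 - 1 / (n : ℝ) ≤ P.real {ω : Ω | ∀ r' : Grid k n → strategySet γ,
          (∀ u, ω ∉ D u → r' u = navigableProfile hg hγ k n u) →
            ReturnsInOneSyncStep (drbPayoff γ) r' (navigableProfile hg hγ k n) ∧
            ReturnsOnceAllMoved (drbPayoff γ) r' (navigableProfile hg hγ k n)} := by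
  have hk1 : 1 ≤ k := hk.le
  have hγ0 : 0 < γ := by linarith
  have hγ1 : γ ≤ 1 := by
    have hg2 : (2 : ℝ) ≤ g := by exact_mod_cast hg
    rw [hγ, div_le_one (by linarith)]; linarith
  obtain ⟨n₀, hn₀⟩ := Filter.eventually_atTop.1
    ((eventually_payoff_gap hk1 hγ0).and
      ((eventually_union_bound hk1 hε0 hε).and (Filter.eventually_ge_atTop 2)))
  refine ⟨n₀, fun n hn p hp Ω _ P _ D hD hind hDp => ?_⟩
  obtain ⟨hgap, hunion, hn2⟩ := hn₀ n hn
  choose B hBcard hB using fun u : Grid k n =>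
    exists_box (boxSide_le (γ := γ) hk1 (by omega : 1 ≤ n) hγ1) u
  have hbad := measureReal_iUnion_biInter_le P hD hind (show 0 ≤ (n : ℝ) ^ (-ε) by positivity)
    (fun u => (hDp u).trans_le (hp u)) B hBcard
  have hcard : ((Fintype.card (Grid k n) : ℕ) : ℝ) = (n : ℝ) ^ k := by simp
  rw [hcard] at hbad
  have hmeas : MeasurableSet (⋃ u, ⋂ v ∈ B u, D v) :=
    .iUnion fun u => Finset.measurableSet_biInter _ fun v _ => hD v
  have hgood : 1 - 1 / (n : ℝ) ≤ P.real (⋃ u, ⋂ v ∈ B u, D v)ᶜ := by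
    rw [MeasureTheory.probReal_compl_eq_one_sub hmeas]
    linarith
  -- Monotonicity suffices: the event in the statement need not be measurable, only the union of
  -- fully perturbed boxes.
  refine hgood.trans (MeasureTheory.measureReal_mono fun ω hω r' hr' => ?_)
  refine returns_of_unique (U := {v | ω ∉ D v})
    (isBestResponse_iff_navigable hk1 hn2 hg hγ hgap fun u => ?_) r' hr'
  simp only [Set.mem_compl_iff, Set.mem_iUnion, Set.mem_iInter, not_exists, not_forall] at hω
  obtain ⟨v, hv, hvD⟩ := hω u
  exact ⟨v, hvD, hB u v hv⟩
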